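/- Let $(R,\mathfrak m)$ be a commutative Noetherian local ring, let $L$ be a finitely generated free $R$-module, and let $M\subseteq L$ be a Burch submodule, i.e. $\mathfrak m\,(M:_L\mathfrak m)\neq \mathfrak m M$, where $(M:_L\mathfrak m)=\{x\in L:\mathfrak m x\subseteq M\}$ (for instance $L=R$ and $M=I$ a Burch ideal of $R$). Suppose that there is an integer $m\ge \max\{\operatorname{depth}(R)-1,\,0\}$ such that $\operatorname{Ext}_R^{i}(M,R)=0$ for $i=m,\,m+1,\,m+2$. Then $R$ is Gorenstein, i.e. $R$ has finite injective dimension as a module over itself. -/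

import Mathlib

open CategoryTheory IsLocalRing

universe u v

namespace BurchSubmodule

/-- The colon submodule `(M :_L I) = {x ∈ L | I x ⊆ M}` of a module `L`, for a submodule `M` of `L`
and an ideal `I` of `R`. -/
def colonIdeal {R : Type u} {L : Type v} [CommRing R] [AddCommGroup L] [Module R L]
    (M : Submodule R L) (I : Ideal R) : Submodule R L where
  carrier := {x | ∀ a ∈ I, a • x ∈ M}
  add_mem' hx hy a ha := by
    rw [smul_add]
    exact M.add_mem (hx a ha) (hy a ha)
  zero_mem' a _ := by
    rw [smul_zero]
    exact M.zero_mem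
  smul_mem' r x hx a ha := by
    rw [smul_comm]
    exact M.smul_mem r (hx a ha)

/-- A submodule `M` of a module `L` over a local ring `(R, 𝔪)` is Burch if
`𝔪 (M :_L 𝔪) ≠ 𝔪 M`. For `L = R` these are the Burch ideals of `R`. -/
def IsBurch {R : Type u} {L : Type v} [CommRing R] [IsLocalRing R] [AddCommGroup L] [Module R L]
    (M : Submodule R L) : Prop :=
  maximalIdeal R • colonIdeal M (maximalIdeal R) ≠ maximalIdeal R • M

/-- The depth of a local ring `(R, 𝔪)`: the supremum of the lengths of the `R`-regular sequences
contained in `𝔪`. -/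
noncomputable def depth (R : Type u) [CommRing R] [IsLocalRing R] : ℕ∞ :=
  ⨆ rs : {rs : List R // (∀ r ∈ rs, r ∈ maximalIdeal R) ∧ RingTheory.Sequence.IsRegular R rs},
    (rs.1.length : ℕ∞)

/-- A Gorenstein local ring: a Noetherian local ring that has finite injective dimension as a
module over itself. -/
structure IsGorensteinLocal (R : Type u) [CommRing R] : Prop where
  isLocalRing : IsLocalRing R
  isNoetherianRing : IsNoetherianRing R
  finite_injectiveDimension :
    ∃ n : ℕ, HasInjectiveDimensionLE (ModuleCat.of R R) n

end BurchSubmodule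

/-! Write 𝔪 for the maximal ideal and k for the residue field. The Burch condition gives x ∈ 𝔪 and y
∈ (M :_L 𝔪) with xy a minimal generator of M. Then M + Ry is an extension of k by M, and its
surjection onto k factors as multiplication by x into M followed by a functional on M. Hence two
consecutive vanishing `Ext` modules of M force one of k (`subsingleton_ext_residue_of_isBurch`),
here Ext^{m+1}(k, R) = 0.

The bound on m prevents all Ext^j(k, R) with j ≤ m from vanishing too, so this is a gap above the
depth. By `subsingleton_ext_residue_of_gap` the gap persists. Let K be an injective resolution of R
and T = Γ_𝔪 K. The gap makes the degree m cycles of T injective, so there is a chain map π : T ⟶ K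
that is the inclusion on cycles up to degree m and zero above. The Koszul augmentation q : P ⟶ K
lifts to T, and following this lift by π gives r • q for a scalar r, since q generates Hom(P, K).
Every shifted map from k to K factors through q. Therefore r acts as 1 on Ext^j(k, R) for j ≤ m and
as 0 for j > m. A nonzero module of the first kind makes r a unit, and then those of the second kind
vanish.

Dévissage with Nakayama (`subsingleton_ext_of_residue`) carries the vanishing from k to all R ⧸ I,
and Baer's criterion with dimension shifting bounds the injective dimension by m. -/

namespace BurchSubmodule

open Abelian

/-! ### Vanishing of `Ext` along short exact sequences. -/

section ExtVanishing

variable {R : Type u} [CommRing R]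

lemma subsingleton_ext_of_linearEquiv {N N' : Type u} [AddCommGroup N] [Module R N]
    [AddCommGroup N'] [Module R N'] (e : N ≃ₗ[R] N') (Y : ModuleCat.{u} R) (i : ℕ)
    (h : Subsingleton (Ext (ModuleCat.of R N') Y i)) :
    Subsingleton (Ext (ModuleCat.of R N) Y i) := by
  refine subsingleton_of_forall_eq 0 fun x ↦ ?_
  have hx : x = (Ext.mk₀ e.toModuleIso.hom).comp
      ((Ext.mk₀ e.toModuleIso.inv).comp x (zero_add i)) (zero_add i) := by
    rw [Ext.mk₀_comp_mk₀_assoc, Iso.hom_inv_id, Ext.mk₀_id_comp]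
  rw [hx, Subsingleton.elim ((Ext.mk₀ e.toModuleIso.inv).comp x (zero_add i)) 0, Ext.comp_zero]

lemma subsingleton_ext_of_exact {N₁ N₂ N₃ : Type u} [AddCommGroup N₁] [Module R N₁]
    [AddCommGroup N₂] [Module R N₂] [AddCommGroup N₃] [Module R N₃] (f : N₁ →ₗ[R] N₂)
    (g : N₂ →ₗ[R] N₃) (hf : Function.Injective f) (hg : Function.Surjective g)
    (hfg : Function.Exact f g) (Y : ModuleCat.{u} R) (i : ℕ)
    (h₁ : Subsingleton (Ext (ModuleCat.of R N₁) Y i))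
    (h₃ : Subsingleton (Ext (ModuleCat.of R N₃) Y i)) :
    Subsingleton (Ext (ModuleCat.of R N₂) Y i) := by
  have hS := ModuleCat.shortComplex_shortExact
    (ModuleCat.shortComplexOfCompEqZero f g hfg.linearMap_comp_eq_zero) hfg hf hg
  refine subsingleton_of_forall_eq 0 fun x ↦ ?_
  obtain ⟨y, rfl⟩ := Ext.contravariant_sequence_exact₂ hS Y x (Subsingleton.elim (α :=
    Ext (ModuleCat.of R N₁) Y i) _ _)
  rw [Subsingleton.elim (α := Ext (ModuleCat.of R N₃) Y i) y 0, Ext.comp_zero]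

/-- If a surjection `g` with kernel `N₁` factors through `N₁`, then the vanishing of two consecutive
`Ext` modules of `N₁` forces the vanishing of one `Ext` module of its target. -/
lemma subsingleton_ext_of_factors {N₁ N₂ N₃ : Type u} [AddCommGroup N₁] [Module R N₁]
    [AddCommGroup N₂] [Module R N₂] [AddCommGroup N₃] [Module R N₃] (f : N₁ →ₗ[R] N₂)
    (a : N₂ →ₗ[R] N₁) (b : N₁ →ₗ[R] N₃) (hf : Function.Injective f)
    (hg : Function.Surjective (b ∘ₗ a)) (hfg : Function.Exact f (b ∘ₗ a))
    (Y : ModuleCat.{u} R) (i : ℕ)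
    (h : Subsingleton (Ext (ModuleCat.of R N₁) Y i))
    (h' : Subsingleton (Ext (ModuleCat.of R N₁) Y (i + 1))) :
    Subsingleton (Ext (ModuleCat.of R N₃) Y (i + 1)) := by
  have hS := ModuleCat.shortComplex_shortExact
    (ModuleCat.shortComplexOfCompEqZero f (b ∘ₗ a) hfg.linearMap_comp_eq_zero) hfg hf hg
  refine subsingleton_of_forall_eq 0 fun x ↦ ?_
  obtain ⟨y, rfl⟩ := Ext.contravariant_sequence_exact₃ hS Y x (n₀ := i) (by
    -- The pullback of `x` to `N₂` passes through Ext^{i+1}(N₁, Y) = 0, so `x` comes from the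
    -- connecting map.
    change (Ext.mk₀ (ModuleCat.ofHom a ≫ ModuleCat.ofHom b)).comp x _ = 0
    rw [← Ext.mk₀_comp_mk₀_assoc, Subsingleton.elim ((Ext.mk₀ (ModuleCat.ofHom b)).comp x _) 0,
      Ext.comp_zero]) (add_comm 1 i)
  rw [Subsingleton.elim (α := Ext (ModuleCat.of R N₁) Y i) y 0, Ext.comp_zero]

end ExtVanishing

/-! ### From a Burch submodule to the residue field. -/

section Burch

variable {R : Type u} [CommRing R] [IsLocalRing R] {L : Type u} [AddCommGroup L] [Module R L]

/-- The inclusion 𝔪M ≤ 𝔪(M :_L 𝔪) always holds, so only the reverse one can fail, and it fails on a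
single product. -/
lemma exists_smul_notMem_of_isBurch {M : Submodule R L} (hM : IsBurch M) :
    ∃ x ∈ maximalIdeal R, ∃ y ∈ colonIdeal M (maximalIdeal R), x • y ∉ maximalIdeal R • M := by
  by_contra! h
  refine hM (le_antisymm (Submodule.smul_le.2 h) (Submodule.smul_mono le_rfl fun z hz a _ ↦ ?_))
  exact M.smul_mem a hz

/-- A minimal generator of a module over a local ring is detected by a functional with values in
the residue field. -/
lemma exists_linearMap_quotient_apply_eq_one {N : Type u} [AddCommGroup N] [Module R N] {z : N}
    (hz : z ∉ maximalIdeal R • (⊤ : Submodule R N)) :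
    ∃ p : N →ₗ[R] (R ⧸ maximalIdeal R), p z = 1 := by
  let : Field (R ⧸ maximalIdeal R) := Ideal.Quotient.field _
  let W := N ⧸ maximalIdeal R • (⊤ : Submodule R N)
  have hz' : (Submodule.Quotient.mk z : W) ≠ 0 := by
    rwa [Ne, Submodule.Quotient.mk_eq_zero]
  obtain ⟨φ, hφ⟩ : ∃ φ : Module.Dual (R ⧸ maximalIdeal R) W, φ (Submodule.Quotient.mk z) ≠ 0 := by
    by_contra! h
    exact hz' ((Module.forall_dual_apply_eq_zero_iff (R ⧸ maximalIdeal R) _).1 h)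
  refine ⟨(((φ (Submodule.Quotient.mk z))⁻¹ • φ).restrictScalars R).comp
    (Submodule.mkQ _), ?_⟩
  exact inv_mul_cancel₀ hφ

lemma linearMap_quotient_apply_eq_zero {N : Type u} [AddCommGroup N] [Module R N]
    (p : N →ₗ[R] (R ⧸ maximalIdeal R)) {z : N}
    (hz : z ∈ maximalIdeal R • (⊤ : Submodule R N)) : p z = 0 := by
  induction hz using Submodule.smul_induction_on' with
  | smul r hr n _ =>
    rw [map_smul, Algebra.smul_def, Ideal.Quotient.algebraMap_eq,
      Ideal.Quotient.eq_zero_iff_mem.2 hr, zero_mul]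
  | add x _ y _ hx hy => rw [map_add, hx, hy, add_zero]

/-- Multiplication by `x` sends M + Ry into M, and `p` sends xy to 1. The composite to k has kernel
exactly M: it kills M because xM ⊆ 𝔪M, and 𝔪y ⊆ M gives the rest. -/
theorem subsingleton_ext_residue_of_isBurch {M : Submodule R L} (hM : IsBurch M)
    (Y : ModuleCat.{u} R) (i : ℕ) (h : Subsingleton (Ext (ModuleCat.of R M) Y i))
    (h' : Subsingleton (Ext (ModuleCat.of R M) Y (i + 1))) :
    Subsingleton (Ext (ModuleCat.of R (R ⧸ maximalIdeal R)) Y (i + 1)) := by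
  obtain ⟨x, hx, y, hy, hxy⟩ := exists_smul_notMem_of_isBurch hM
  have hxyM : x • y ∈ M := hy x hx
  let M' : Submodule R L := M ⊔ R ∙ y
  have hM' : ∀ z ∈ M', x • z ∈ M := fun z hz ↦ by
    obtain ⟨m, hm, n, hn, rfl⟩ := Submodule.mem_sup.1 hz
    obtain ⟨r, rfl⟩ := Submodule.mem_span_singleton.1 hn
    rw [smul_add, smul_comm]
    exact M.add_mem (M.smul_mem _ hm) (M.smul_mem _ hxyM)
  let a : M' →ₗ[R] M := (LinearMap.lsmul R L x).restrict hM'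
  let f : M →ₗ[R] M' := Submodule.inclusion le_sup_left
  obtain ⟨p, hp⟩ := exists_linearMap_quotient_apply_eq_one (z := (⟨x • y, hxyM⟩ : M))
    (by rwa [Submodule.mem_smul_top_iff])
  have hyM' : y ∈ M' := Submodule.mem_sup_right (Submodule.mem_span_singleton_self y)
  have hpa : p (a ⟨y, hyM'⟩) = 1 := hp
  have hpf : ∀ m : M, p (a (f m)) = 0 := fun m ↦ linearMap_quotient_apply_eq_zero p (by
    rw [Submodule.mem_smul_top_iff]
    exact Submodule.smul_mem_smul hx m.2)
  refine subsingleton_ext_of_factors f a p (Submodule.inclusion_injective _) (fun c ↦ ?_)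
    (fun z ↦ ⟨fun hz ↦ ?_, ?_⟩) Y i h h'
  · obtain ⟨r, rfl⟩ := Ideal.Quotient.mk_surjective c
    refine ⟨r • ⟨y, hyM'⟩, ?_⟩
    rw [map_smul, LinearMap.comp_apply, hpa, Algebra.smul_def, mul_one]
    rfl
  · obtain ⟨z, hz'⟩ := z
    obtain ⟨m, hm, n, hn, rfl⟩ := Submodule.mem_sup.1 hz'
    obtain ⟨r, rfl⟩ := Submodule.mem_span_singleton.1 hn
    have hz₂ : (⟨m + r • y, hz'⟩ : M') = f ⟨m, hm⟩ + r • ⟨y, hyM'⟩ := rfl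
    rw [hz₂, LinearMap.comp_apply, map_add, map_add, hpf, map_smul, map_smul, hpa, zero_add,
      Algebra.smul_def, mul_one] at hz
    have hr : r ∈ maximalIdeal R := Ideal.Quotient.eq_zero_iff_mem.1 hz
    exact ⟨⟨m + r • y, M.add_mem hm (hy r hr)⟩, rfl⟩
  · rintro ⟨m, rfl⟩
    exact hpf m

end Burch

open scoped Pointwise in
lemma annihilator_quotSMulTop {R : Type u} [CommRing R] (p : Ideal R) (x : R) :
    p ≤ Module.annihilator R (QuotSMulTop x (R ⧸ p)) ∧
      x ∈ Module.annihilator R (QuotSMulTop x (R ⧸ p)) := by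
  constructor
  · refine le_trans (Ideal.annihilator_quotient (I := p)).ge
      (LinearMap.annihilator_le_of_surjective _
        (Submodule.mkQ_surjective (x • (⊤ : Submodule R (R ⧸ p)))))
  · refine Module.mem_annihilator.2 fun z ↦ ?_
    obtain ⟨z, rfl⟩ := Submodule.Quotient.mk_surjective _ z
    rw [← Submodule.Quotient.mk_smul, Submodule.Quotient.mk_eq_zero]
    exact Submodule.smul_mem_pointwise_smul _ _ _ trivial

/-! ### Dévissage from the residue field to finitely generated modules. -/

section Devissage

variable {R : Type u} [CommRing R] [IsNoetherianRing R]

/-- Dévissage: a finitely generated module `N` has vanishing `i`-th `Ext` as soon as this holds for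
`R ⧸ p` for all primes `p` containing the annihilator of `N`. -/
lemma subsingleton_ext_of_forall_prime (Y : ModuleCat.{u} R) (i : ℕ) (N : Type u) [AddCommGroup N]
    [Module R N] [Module.Finite R N]
    (h : ∀ p : Ideal R, p.IsPrime → Module.annihilator R N ≤ p →
      Subsingleton (Ext (ModuleCat.of R (R ⧸ p)) Y i)) :
    Subsingleton (Ext (ModuleCat.of R N) Y i) := by
  induction ‹Module.Finite R N› using
    IsNoetherianRing.induction_on_isQuotientEquivQuotientPrime R with
  | subsingleton N =>
    refine subsingleton_of_forall_eq 0 fun x ↦ ?_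
    rw [← Ext.mk₀_id_comp x, (ModuleCat.isZero_of_subsingleton (ModuleCat.of R N)).eq_of_src (𝟙 _) 0,
      Ext.mk₀_zero, Ext.zero_comp]
  | quotient N p e =>
    refine subsingleton_ext_of_linearEquiv e Y i (h p.1 p.2 ?_)
    rw [e.annihilator_eq, Ideal.annihilator_quotient]
  | exact N₁ N₂ N₃ f g hf hg hfg h₁ h₃ =>
    exact subsingleton_ext_of_exact f g hf hg hfg Y i
      (h₁ fun p hp hle ↦ h p hp ((f.annihilator_le_of_injective hf).trans hle))
      (h₃ fun p hp hle ↦ h p hp ((g.annihilator_le_of_surjective hg).trans hle))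

lemma subsingleton_ext_of_pow_le_annihilator [IsLocalRing R] (Y : ModuleCat.{u} R) (i : ℕ)
    (h : Subsingleton (Ext (ModuleCat.of R (R ⧸ maximalIdeal R)) Y i)) (N : Type u)
    [AddCommGroup N] [Module R N] [Module.Finite R N] (c : ℕ)
    (hc : maximalIdeal R ^ c ≤ Module.annihilator R N) :
    Subsingleton (Ext (ModuleCat.of R N) Y i) := by
  refine subsingleton_ext_of_forall_prime Y i N fun p hp hle ↦ ?_
  have : maximalIdeal R ≤ p := hp.le_of_pow_le (hc.trans hle)
  rwa [← (maximalIdeal.isMaximal R).eq_of_le hp.ne_top this]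

/-- If all `Ext` modules of the residue field vanish from degree `i` on, then so do those of every
finitely generated module. -/
lemma subsingleton_ext_of_residue [IsLocalRing R] (Y : ModuleCat.{u} R) [Module.Finite R Y] (i : ℕ)
    (h : ∀ j, i ≤ j → Subsingleton (Ext (ModuleCat.of R (R ⧸ maximalIdeal R)) Y j))
    (N : Type u) [AddCommGroup N] [Module R N] [Module.Finite R N] (j : ℕ) (hj : i ≤ j) :
    Subsingleton (Ext (ModuleCat.of R N) Y j) := by
  suffices H : ∀ p : Ideal R, p.IsPrime → ∀ j, i ≤ j →
      Subsingleton (Ext (ModuleCat.of R (R ⧸ p)) Y j) from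
    subsingleton_ext_of_forall_prime Y j N fun p hp _ ↦ H p hp j hj
  -- Noetherian induction on primes from above, for all degrees `j ≥ i` at once, because the step at
  -- `p` in degree `j` needs larger primes in degree `j + 1`.
  intro p
  induction p using WellFoundedGT.induction with
  | ind p ih =>
  intro hp j hj
  by_cases hpm : p = maximalIdeal R
  · rw [hpm]
    exact h j hj
  obtain ⟨x, hx, hxp⟩ : ∃ x ∈ maximalIdeal R, x ∉ p := by
    by_contra! H
    exact hpm ((IsLocalRing.le_maximalIdeal hp.ne_top).antisymm H)
  have hreg : IsSMulRegular (ModuleCat.of R (R ⧸ p)) x := by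
    intro a b hab
    obtain ⟨a, rfl⟩ := Ideal.Quotient.mk_surjective a
    obtain ⟨b, rfl⟩ := Ideal.Quotient.mk_surjective b
    have hab' : Ideal.Quotient.mk p (x * a) = Ideal.Quotient.mk p (x * b) := hab
    rw [Ideal.Quotient.eq, ← mul_sub] at hab'
    exact Ideal.Quotient.eq.2 ((hp.mem_or_mem hab').resolve_left hxp)
  have hS := hreg.smulShortComplex_shortExact
  have h₃ : Subsingleton (Ext (ModuleCat.of R (QuotSMulTop x (R ⧸ p))) Y (j + 1)) := by
    obtain ⟨hle, hx'⟩ := annihilator_quotSMulTop p x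
    refine subsingleton_ext_of_forall_prime Y (j + 1) _ fun q hq hle' ↦
      ih q (lt_of_le_of_ne (hle.trans hle') ?_) hq (j + 1) (by lia)
    rintro rfl
    exact hxp (hle' hx')
  -- Vanishing at `h₃` makes multiplication by `x` surjective on Ext^j(R ⧸ p, Y), which is finitely
  -- generated; Nakayama then kills it.
  have htop : (⊤ : Submodule R (Ext (ModuleCat.of R (R ⧸ p)) Y j)) ≤
      Ideal.span {x} • (⊤ : Submodule R (Ext (ModuleCat.of R (R ⧸ p)) Y j)) := by
    intro z _
    obtain ⟨w, hw⟩ : ∃ w : Ext (ModuleCat.of R (R ⧸ p)) Y j,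
        (Ext.mk₀ (x • 𝟙 (ModuleCat.of R (R ⧸ p)))).comp w (zero_add j) = z := by
      rw [← ModuleCat.smulShortComplex_f_eq_smul_id]
      exact Ext.contravariant_sequence_exact₁ hS Y z (add_comm 1 j)
        (Subsingleton.elim (α := Ext (ModuleCat.of R (QuotSMulTop x (R ⧸ p))) Y (j + 1)) _ _)
    rw [← hw, Ext.mk₀_smul, Ext.smul_comp]
    exact Submodule.smul_mem_smul (Ideal.mem_span_singleton_self x) trivial
  have hbot := Submodule.eq_bot_of_le_smul_of_le_jacobson_bot (Ideal.span {x}) _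
    (Module.Finite.fg_top (R := R) (M := Ext (ModuleCat.of R (R ⧸ p)) Y j)) htop
    (by
      rw [IsLocalRing.jacobson_eq_maximalIdeal ⊥ bot_ne_top, Ideal.span_singleton_le_iff_mem]
      exact hx)
  exact (Submodule.subsingleton_iff R).1 (subsingleton_of_bot_eq_top hbot.symm)

end Devissage

/-! ### Injective dimension tested on cyclic modules. -/

section InjectiveDimension

variable {R : Type u} [CommRing R]

/-- Baer's criterion in terms of `Ext`. -/
lemma injective_of_subsingleton_ext_one (Y : ModuleCat.{u} R)
    (h : ∀ I : Ideal R, Subsingleton (Ext (ModuleCat.of R (R ⧸ I)) Y 1)) : Injective Y := by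
  rw [← Module.injective_iff_injective_object R Y, ← Module.Baer.iff_injective]
  intro I g
  have hS := ModuleCat.shortComplex_shortExact (ModuleCat.shortComplexOfCompEqZero
    I.subtype I.mkQ (LinearMap.exact_subtype_mkQ I).linearMap_comp_eq_zero)
    (LinearMap.exact_subtype_mkQ I) I.injective_subtype
    I.mkQ_surjective
  obtain ⟨z, hz⟩ := Ext.contravariant_sequence_exact₁ hS Y (Ext.mk₀ (ModuleCat.ofHom g))
    (add_zero 1) (Subsingleton.elim (α := Ext (ModuleCat.of R (R ⧸ I)) Y 1) _ _)
  obtain ⟨z, rfl⟩ := (Ext.mk₀_bijective _ _).2 z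
  rw [Ext.mk₀_comp_mk₀] at hz
  have hz' := (Ext.mk₀_bijective _ _).1 hz
  exact ⟨z.hom, fun r hr ↦ congr($hz' ⟨r, hr⟩)⟩

lemma hasInjectiveDimensionLE_of_subsingleton_ext (n : ℕ) (Y : ModuleCat.{u} R)
    (h : ∀ I : Ideal R, Subsingleton (Ext (ModuleCat.of R (R ⧸ I)) Y (n + 1))) :
    HasInjectiveDimensionLE Y n := by
  induction n generalizing Y with
  | zero =>
    have := injective_of_subsingleton_ext_one Y h
    exact inferInstanceAs (HasInjectiveDimensionLT Y 1)
  | succ n ih =>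
    -- Dimension shifting: the cokernel of an embedding into an injective satisfies the hypothesis
    -- one degree lower.
    let ⟨E, _, f, _⟩ := EnoughInjectives.presentation Y
    let S := ShortComplex.mk f (Limits.cokernel.π f) (Limits.cokernel.condition f)
    have hS : S.ShortExact := { exact := ShortComplex.exact_cokernel f }
    refine (hS.hasInjectiveDimensionLT_X₃_iff n inferInstance).1
      (ih _ fun I ↦ subsingleton_of_forall_eq 0 fun x ↦ ?_)
    obtain ⟨y, rfl⟩ := Ext.covariant_sequence_exact₃ _ hS x rfl
      ((h I).elim _ _)
    rw [Ext.eq_zero_of_injective y, Ext.zero_comp]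

end InjectiveDimension

/-! ### Depth and `Ext` of the residue field. -/

section Depth

variable {R : Type u} [CommRing R] [IsLocalRing R] [IsNoetherianRing R]

lemma le_depth_of_subsingleton_ext (n : ℕ)
    (h : ∀ j < n, Subsingleton (Ext (ModuleCat.of R (R ⧸ maximalIdeal R)) (ModuleCat.of R R) j)) :
    (n : ℕ∞) ≤ depth R := by
  obtain ⟨rs, hlen, hmem, hreg⟩ := ModuleCat.exists_isRegular_of_exists_subsingleton_ext
    (maximalIdeal R) n (ModuleCat.of R R) (lt_top_iff_ne_top.2 (by
      change maximalIdeal R • (⊤ : Ideal R) ≠ ⊤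
      rw [smul_eq_mul, Ideal.mul_top]
      exact Ideal.IsPrime.ne_top')) (ModuleCat.of R (R ⧸ maximalIdeal R))
    (by rw [Module.support_eq_zeroLocus, Ideal.annihilator_quotient]) h
  rw [← hlen]
  exact le_iSup_of_le ⟨rs, hmem, hreg⟩ le_rfl

end Depth

/-! ### Power torsion in injective modules. -/

section PowTorsion

variable {R : Type u} [CommRing R]

/-- The submodule of elements killed by a power of the ideal `𝔞`. -/
def powTorsion (𝔞 : Ideal R) (N : Type v) [AddCommGroup N] [Module R N] : Submodule R N where
  carrier := {y | ∃ c : ℕ, ∀ a ∈ 𝔞 ^ c, a • y = 0}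
  add_mem' := by
    rintro y z ⟨c, hc⟩ ⟨c', hc'⟩
    refine ⟨c + c', fun a ha ↦ ?_⟩
    rw [smul_add, hc a (Ideal.pow_le_pow_right (Nat.le_add_right _ _) ha),
      hc' a (Ideal.pow_le_pow_right (Nat.le_add_left _ _) ha), add_zero]
  zero_mem' := ⟨0, fun a _ ↦ smul_zero a⟩
  smul_mem' := by
    rintro r y ⟨c, hc⟩
    exact ⟨c, fun a ha ↦ by rw [smul_comm, hc a ha, smul_zero]⟩

variable {N N' : Type v} [AddCommGroup N] [Module R N] [AddCommGroup N'] [Module R N']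

lemma powTorsion_anti {𝔞 𝔟 : Ideal R} (h : 𝔞 ≤ 𝔟) : powTorsion 𝔟 N ≤ powTorsion 𝔞 N :=
  fun _ ⟨c, hc⟩ ↦ ⟨c, fun a ha ↦ hc a (Ideal.pow_right_mono h c ha)⟩

lemma powTorsion_bot : powTorsion (⊥ : Ideal R) N = ⊤ := by
  refine eq_top_iff.2 fun y _ ↦ ⟨1, fun a ha ↦ ?_⟩
  rw [pow_one, Ideal.mem_bot] at ha
  rw [ha, zero_smul]

lemma map_mem_powTorsion (𝔞 : Ideal R) (f : N →ₗ[R] N') {y : N} (hy : y ∈ powTorsion 𝔞 N) :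
    f y ∈ powTorsion 𝔞 N' := by
  obtain ⟨c, hc⟩ := hy
  exact ⟨c, fun a ha ↦ by rw [← map_smul, hc a ha, map_zero]⟩

lemma mem_powTorsion_sup {𝔞 : Ideal R} {x : R} {y : N} (hy : y ∈ powTorsion 𝔞 N) (c : ℕ)
    (hx : x ^ c • y = 0) : y ∈ powTorsion (Ideal.span {x} ⊔ 𝔞) N := by
  obtain ⟨n, hn⟩ := hy
  refine ⟨c + n, fun a ha ↦ ?_⟩
  obtain ⟨b, hb, b', hb', rfl⟩ := Submodule.mem_sup.1 (Ideal.sup_pow_add_le_pow_sup_pow ha)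
  rw [Ideal.span_singleton_pow] at hb
  obtain ⟨r, rfl⟩ := Ideal.mem_span_singleton'.1 hb
  rw [add_smul, hn b' hb', mul_smul, hx, smul_zero, add_zero]

lemma mem_powTorsion_sup_of_smul_mem {𝔞 : Ideal R} {x : R} {y : N} (hy : y ∈ powTorsion 𝔞 N)
    (hx : x • y ∈ powTorsion (Ideal.span {x} ⊔ 𝔞) N) :
    y ∈ powTorsion (Ideal.span {x} ⊔ 𝔞) N := by
  obtain ⟨c, hc⟩ := hx
  refine mem_powTorsion_sup hy (c + 1) ?_
  rw [pow_succ, mul_smul]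
  exact hc _ (Ideal.pow_mem_pow (Ideal.mem_sup_left (Ideal.mem_span_singleton_self x)) c)

/-- A linear map from a finitely generated module to a power torsion module is killed by a single
power. -/
lemma exists_pow_smul_apply_eq_zero {𝔞 : Ideal R} [Module.Finite R N] (φ : N →ₗ[R] N')
    (hφ : ∀ y, φ y ∈ powTorsion 𝔞 N') : ∃ c : ℕ, ∀ a ∈ 𝔞 ^ c, ∀ y, a • φ y = 0 := by
  obtain ⟨s, hs⟩ := Module.Finite.fg_top (R := R) (M := N)
  choose c hc using hφ
  refine ⟨s.sup c, fun a ha ↦ ?_⟩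
  have : (⊤ : Submodule R N) ≤ LinearMap.ker (a • φ) := by
    rw [← hs, Submodule.span_le]
    intro y hy
    exact hc y a (Ideal.pow_le_pow_right (Finset.le_sup hy) ha)
  exact fun y ↦ this (Submodule.mem_top (x := y))

variable [IsNoetherianRing R] {E : Type u} [AddCommGroup E] [Module R E] [Module.Injective R E]

/-- By the Artin–Rees lemma, a map from an ideal to an injective module which is killed by a power
of `𝔞` extends to `R` in such a way that the extension is killed by a power of `𝔞`. -/
lemma exists_extension_pow_eq_zero (𝔞 𝔟 : Ideal R) (φ : 𝔟 →ₗ[R] E) (n : ℕ)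
    (hφ : ∀ a ∈ 𝔞 ^ n, ∀ y, a • φ y = 0) :
    ∃ (c : ℕ) (ψ : R →ₗ[R] E), (∀ b : 𝔟, ψ b = φ b) ∧ ∀ a ∈ 𝔞 ^ c, ψ a = 0 := by
  obtain ⟨k, hk⟩ := Ideal.exists_pow_inf_eq_pow_smul 𝔞 (𝔟 : Submodule R R)
  have hker : Submodule.comap 𝔟.subtype (𝔞 ^ (k + n)) ≤ LinearMap.ker φ := by
    intro b hb
    have hb' : (b : R) ∈ 𝔞 ^ n • 𝔟 := by
      have := hk (k + n) (Nat.le_add_right _ _)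
      rw [Nat.add_sub_cancel_left] at this
      refine Submodule.smul_mono le_rfl inf_le_right (this.le ⟨?_, b.2⟩)
      rw [smul_eq_mul, Ideal.mul_top]
      exact hb
    rw [← Submodule.mem_smul_top_iff] at hb'
    refine (Submodule.smul_le.2 fun r hr y _ ↦ ?_ :
      𝔞 ^ n • (⊤ : Submodule R 𝔟) ≤ LinearMap.ker φ) hb'
    rw [LinearMap.mem_ker, map_smul, hφ r hr y]
  let f : (𝔟 ⧸ Submodule.comap 𝔟.subtype (𝔞 ^ (k + n))) →ₗ[R] R ⧸ 𝔞 ^ (k + n) :=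
    Submodule.mapQ _ _ 𝔟.subtype le_rfl
  obtain ⟨h, hh⟩ := Module.Injective.out f (LinearMap.ker_eq_bot.1
    (Submodule.ker_liftQ_eq_bot _ _ _ (by rw [LinearMap.ker_comp, Submodule.ker_mkQ])))
    (Submodule.liftQ _ φ hker)
  refine ⟨k + n, h ∘ₗ (𝔞 ^ (k + n)).mkQ, fun b ↦ hh (Submodule.Quotient.mk b), fun a ha ↦ ?_⟩
  rw [LinearMap.comp_apply, Submodule.mkQ_apply, (Submodule.Quotient.mk_eq_zero _).2 ha, map_zero]

instance injective_powTorsion (𝔞 : Ideal R) : Module.Injective R (powTorsion 𝔞 E) := by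
  rw [← Module.Baer.iff_injective]
  intro 𝔟 φ
  obtain ⟨n, hn⟩ := exists_pow_smul_apply_eq_zero ((powTorsion 𝔞 E).subtype ∘ₗ φ)
    (fun y ↦ (φ y).2)
  obtain ⟨c, ψ, hψ, hψ'⟩ := exists_extension_pow_eq_zero 𝔞 𝔟 _ n hn
  refine ⟨ψ.codRestrict _ fun r ↦ ⟨c, fun a ha ↦ ?_⟩, fun b hb ↦ Subtype.ext (hψ ⟨b, hb⟩)⟩
  rw [← map_smul, smul_eq_mul]
  exact hψ' _ (Ideal.mul_mem_right _ _ ha)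

/-- Multiplication by `x` is surjective on `Γ_𝔞(E) / Γ_{(x) + 𝔞}(E)`, for `E` injective. -/
lemma exists_sub_smul_mem_powTorsion_sup (𝔞 : Ideal R) (x : R) {y : E}
    (hy : y ∈ powTorsion 𝔞 E) :
    ∃ z ∈ powTorsion 𝔞 E, y - x • z ∈ powTorsion (Ideal.span {x} ⊔ 𝔞) E := by
  -- Once the annihilators of the powers of `x` stabilize at `c`, the assignment x^{c+1} ↦ x^c y is
  -- well defined on the ideal (x^{c+1}). Extending it to R by injectivity of Γ_𝔞(E) yields z with
  -- x^{c+1} z = x^c y, so y - xz is killed by x^c.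
  let F : ℕ →o Submodule R R :=
    ⟨fun n ↦ LinearMap.ker (LinearMap.lsmul R R (x ^ n)), monotone_nat_of_le_succ fun n r hr ↦ by
      have hr' : x ^ n * r = 0 := hr
      change x ^ (n + 1) * r = 0
      rw [pow_succ', mul_assoc, hr', mul_zero]⟩
  obtain ⟨c, hc⟩ := monotone_stabilizes_iff_noetherian.2 ‹IsNoetherianRing R› F
  have hker : F (c + 1) ≤ LinearMap.ker
      (LinearMap.toSpanSingleton R (powTorsion 𝔞 E) (x ^ c • ⟨y, hy⟩)) := by
    rw [← hc (c + 1) (Nat.le_succ c)]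
    intro r hr
    have hr' : x ^ c * r = 0 := hr
    rw [LinearMap.mem_ker, LinearMap.toSpanSingleton_apply, smul_smul, mul_comm, hr', zero_smul]
  let f : (R ⧸ F (c + 1)) →ₗ[R] R := Submodule.liftQ _ (LinearMap.lsmul R R (x ^ (c + 1))) le_rfl
  obtain ⟨h, hh⟩ := Module.Injective.out f
    (LinearMap.ker_eq_bot.1 (Submodule.ker_liftQ_eq_bot' _ _ rfl)) (Submodule.liftQ _ _ hker)
  have h₁ : x ^ (c + 1) • h 1 = x ^ c • ⟨y, hy⟩ := by
    have := hh (Submodule.Quotient.mk 1)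
    rw [Submodule.liftQ_apply, Submodule.liftQ_apply, LinearMap.lsmul_apply, map_smul,
      LinearMap.toSpanSingleton_apply, one_smul] at this
    exact this
  refine ⟨h 1, (h 1).2, mem_powTorsion_sup
    (Submodule.sub_mem _ hy (Submodule.smul_mem _ _ (h 1).2)) c ?_⟩
  rw [smul_sub, smul_smul, ← pow_succ, sub_eq_zero]
  exact (congr_arg Subtype.val h₁).symm

/-- Let `E → E' → E''` be a complex with `E` injective. If maps from `R ⧸ 𝔠` into the cycles of `E'`
lift to `E` for all `𝔠` containing a power of `𝔞`, then the `𝔞`-power torsion cycles of `E` form an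
injective module. -/
lemma injective_ker_inf_powTorsion {E' E'' : Type u} [AddCommGroup E'] [Module R E']
    [AddCommGroup E''] [Module R E''] (d : E →ₗ[R] E') (d' : E' →ₗ[R] E'') (hdd : d' ∘ₗ d = 0)
    (𝔞 : Ideal R) (h : ∀ (𝔠 : Ideal R) (c : ℕ), 𝔞 ^ c ≤ 𝔠 → ∀ g : (R ⧸ 𝔠) →ₗ[R] E',
      d' ∘ₗ g = 0 → ∃ t : (R ⧸ 𝔠) →ₗ[R] E, d ∘ₗ t = g) :
    Module.Injective R (LinearMap.ker d ⊓ powTorsion 𝔞 E : Submodule R E) := by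
  rw [← Module.Baer.iff_injective]
  intro 𝔟 φ
  obtain ⟨n, hn⟩ := exists_pow_smul_apply_eq_zero
    ((LinearMap.ker d ⊓ powTorsion 𝔞 E : Submodule R E).subtype ∘ₗ φ) (fun y ↦ (φ y).2.2)
  obtain ⟨c, ψ, hψ, hψ'⟩ := exists_extension_pow_eq_zero 𝔞 𝔟 _ n hn
  have hker : 𝔟 ⊔ 𝔞 ^ c ≤ LinearMap.ker (d ∘ₗ ψ) := by
    refine sup_le (fun b hb ↦ ?_) (fun a ha ↦ ?_)
    · rw [LinearMap.mem_ker, LinearMap.comp_apply, hψ ⟨b, hb⟩]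
      exact (φ ⟨b, hb⟩).2.1
    · rw [LinearMap.mem_ker, LinearMap.comp_apply, hψ' a ha, map_zero]
  -- The extension `ψ` need not take values in cycles. Its defect `d ∘ₗ ψ` factors through R ⧸ (𝔟 ⊔
  -- 𝔞^c), hence lifts to some `t`; subtracting `t` corrects `ψ` without changing it on 𝔟.
  obtain ⟨t, ht⟩ := h (𝔟 ⊔ 𝔞 ^ c) c le_sup_right (Submodule.liftQ _ (d ∘ₗ ψ) hker) (by
    ext
    exact congr($hdd (ψ 1)))
  have hmem : ∀ r, ψ r - t (Submodule.Quotient.mk r) ∈ LinearMap.ker d ⊓ powTorsion 𝔞 E := by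
    refine fun r ↦ ⟨?_, c, fun a ha ↦ ?_⟩
    · change d (_ - _) = 0
      rw [map_sub, sub_eq_zero]
      exact congr($ht (Submodule.Quotient.mk r)).symm
    · have har : a * r ∈ 𝔞 ^ c := Ideal.mul_mem_right _ _ ha
      rw [smul_sub, ← map_smul, ← map_smul, ← Submodule.Quotient.mk_smul, smul_eq_mul, hψ' _ har,
        (Submodule.Quotient.mk_eq_zero _).2 (Ideal.mem_sup_right har), map_zero, sub_zero]
  refine ⟨(ψ - t ∘ₗ Submodule.mkQ _).codRestrict _ hmem, fun b hb ↦ Subtype.ext ?_⟩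
  change ψ b - t (Submodule.Quotient.mk b) = φ ⟨b, hb⟩
  rw [(Submodule.Quotient.mk_eq_zero _).2 (Ideal.mem_sup_left hb), map_zero, sub_zero]
  exact hψ ⟨b, hb⟩

end PowTorsion

/-! ### Koszul objects in a linear triangulated category. -/

section KoszulTower

open Pretriangulated Limits

universe w w'

lemma eq_zero_of_shift_neg_one {𝒟 : Type w} [Category.{w'} 𝒟] [Preadditive 𝒟] [HasShift 𝒟 ℤ]
    [∀ n : ℤ, (shiftFunctor 𝒟 n).Additive] {P A : 𝒟} (n m : ℤ) (hnm : n + 1 = m)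
    (h : ∀ f : P ⟶ A⟦m⟧, f = 0) (f : P⟦(-1 : ℤ)⟧ ⟶ A⟦n⟧) : f = 0 := by
  apply (shiftFunctor 𝒟 (1 : ℤ)).map_injective
  rw [Functor.map_zero, ← cancel_epi ((shiftFunctorCompIsoId 𝒟 (-1 : ℤ) 1 (by simp)).inv.app P),
    ← cancel_mono ((shiftFunctorAdd' 𝒟 n 1 m hnm).inv.app A), comp_zero, zero_comp]
  exact h _

variable {R : Type u} [CommRing R] {𝒟 : Type w} [Category.{w'} 𝒟] [Preadditive 𝒟] [Linear R 𝒟]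
  [HasZeroObject 𝒟] [HasShift 𝒟 ℤ] [∀ n : ℤ, (shiftFunctor 𝒟 n).Additive] [Pretriangulated 𝒟]

/-- A morphism `q : P ⟶ A` obtained by successively taking fibres of the multiplications by the
elements of a list, starting from `𝟙 A`. For `A = R` in the derived category, `P` is a Koszul
complex. -/
inductive KoszulTower (A : 𝒟) : List R → ∀ P : 𝒟, (P ⟶ A) → Prop
  | nil : KoszulTower A [] A (𝟙 A)
  | cons {xs : List R} {P P' : 𝒟} {q : P ⟶ A} (x : R) (p : P' ⟶ P) (h : P ⟶ P'⟦(1 : ℤ)⟧)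
      (hP : KoszulTower A xs P q) (hT : Triangle.mk p (x • 𝟙 P) h ∈ distTriang 𝒟) :
      KoszulTower A (x :: xs) P' (p ≫ q)

variable {A : 𝒟}

lemma exists_koszulTower (A : 𝒟) (xs : List R) : ∃ (P : 𝒟) (q : P ⟶ A), KoszulTower A xs P q := by
  induction xs with
  | nil => exact ⟨A, 𝟙 A, .nil⟩
  | cons x xs ih =>
    obtain ⟨P, q, hP⟩ := ih
    obtain ⟨P', p, h, hT⟩ := distinguished_cocone_triangle₁ (x • 𝟙 P)
    exact ⟨P', p ≫ q, .cons x p h hP hT⟩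

lemma exists_comp_eq_of_distTriang {P' P P'' Y : 𝒟} {p : P' ⟶ P} {e : P ⟶ P''}
    {h : P'' ⟶ P'⟦(1 : ℤ)⟧} (hT : Triangle.mk p e h ∈ distTriang 𝒟) (g : Y ⟶ P) (hg : g ≫ e = 0) :
    ∃ g' : Y ⟶ P', g' ≫ p = g := by
  obtain ⟨g', hg'⟩ := Triangle.coyoneda_exact₂ _ hT g hg
  exact ⟨g', hg'.symm⟩

lemma exists_eq_comp_of_distTriang {P' P P'' X : 𝒟} {p : P' ⟶ P} {e : P ⟶ P''}
    {h : P'' ⟶ P'⟦(1 : ℤ)⟧} (hT : Triangle.mk p e h ∈ distTriang 𝒟)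
    (hX : ∀ k : P''⟦(-1 : ℤ)⟧ ⟶ X, k = 0) (f : P' ⟶ X) : ∃ g : P ⟶ X, f = p ≫ g :=
  Triangle.yoneda_exact₂ _ (inv_rot_of_distTriang _ hT) f (hX _)

/-- Each stage is the fibre of a multiplication that acts as zero on maps from `Y`, so the map lifts
stage by stage. -/
lemma KoszulTower.exists_factor {xs : List R} {P : 𝒟} {q : P ⟶ A} (hP : KoszulTower A xs P q)
    {Y : 𝒟} (hY : ∀ x ∈ xs, x • 𝟙 Y = 0) (f : Y ⟶ A) : ∃ g : Y ⟶ P, g ≫ q = f := by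
  induction hP with
  | nil => exact ⟨f, Category.comp_id f⟩
  | cons x p h _ hT ih =>
    obtain ⟨g, rfl⟩ := ih fun x hx ↦ hY x (List.mem_cons_of_mem _ hx)
    obtain ⟨g', hg'⟩ := exists_comp_eq_of_distTriang hT g (by
      rw [Linear.comp_smul, Category.comp_id, ← Category.id_comp g, ← Linear.smul_comp,
        hY x List.mem_cons_self, zero_comp])
    exact ⟨g', by rw [← Category.assoc, hg']⟩

lemma KoszulTower.hom_shift_eq_zero {xs : List R} {P : 𝒟} {q : P ⟶ A} (hP : KoszulTower A xs P q)
    (hA : ∀ (n : ℤ) (_ : 1 ≤ n) (f : A ⟶ A⟦n⟧), f = 0) :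
    ∀ (n : ℤ) (_ : 1 ≤ n) (f : P ⟶ A⟦n⟧), f = 0 := by
  induction hP with
  | nil => exact hA
  | cons x p h _ hT ih =>
    intro n hn f
    obtain ⟨g, rfl⟩ := exists_eq_comp_of_distTriang hT
      (eq_zero_of_shift_neg_one n (n + 1) rfl (ih (n + 1) (by lia))) f
    rw [ih n hn g, comp_zero]

/-- The obstruction to extending a map along `p : P' ⟶ P` lies in Hom(P⟦-1⟧, A), that is, in Hom(P,
A⟦1⟧) = 0. -/
lemma KoszulTower.exists_eq_smul {xs : List R} {P : 𝒟} {q : P ⟶ A} (hP : KoszulTower A xs P q)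
    (hA : ∀ (n : ℤ) (_ : 1 ≤ n) (f : A ⟶ A⟦n⟧), f = 0)
    (hA' : ∀ f : A ⟶ A, ∃ r : R, f = r • 𝟙 A) (f : P ⟶ A) : ∃ r : R, f = r • q := by
  induction hP with
  | nil => exact hA' f
  | cons x p h hP hT ih =>
    obtain ⟨g, rfl⟩ := exists_eq_comp_of_distTriang hT (fun k ↦ by
      rw [← cancel_mono ((shiftFunctorZero 𝒟 ℤ).inv.app A), zero_comp]
      exact eq_zero_of_shift_neg_one 0 1 (by simp) (hP.hom_shift_eq_zero hA 1 le_rfl) _) f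
    obtain ⟨r, rfl⟩ := ih g
    exact ⟨r, Linear.comp_smul _ _ _ _ _ _⟩

/-- The obstruction `p ≫ w ≫ e` is killed by `x`, because `x • p = 0`, while `x` is invertible on
`E`. -/
lemma exists_lift_fibre {P P' J J' E : 𝒟} {x : R} {p : P' ⟶ P} {h : P ⟶ P'⟦(1 : ℤ)⟧}
    (hT : Triangle.mk p (x • 𝟙 P) h ∈ distTriang 𝒟) {j : J' ⟶ J} {e : J ⟶ E}
    {h' : E ⟶ J'⟦(1 : ℤ)⟧} (hT' : Triangle.mk j e h' ∈ distTriang 𝒟) [IsIso (x • 𝟙 E)]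
    (w : P ⟶ J) : ∃ w' : P' ⟶ J', w' ≫ j = p ≫ w := by
  refine exists_comp_eq_of_distTriang hT' (p ≫ w) ?_
  have h₀ : p ≫ (x • 𝟙 P) = 0 := comp_distTriang_mor_zero₁₂ _ hT
  rw [Linear.comp_smul, Category.comp_id] at h₀
  rw [← cancel_mono (x • 𝟙 E), zero_comp, Linear.comp_smul, Category.comp_id, ← Linear.smul_comp,
    ← Linear.smul_comp, h₀, zero_comp, zero_comp]

end KoszulTower

/-! ### Power torsion subcomplexes and lifting of Koszul augmentations. -/

section PowTorsionComplex

open Limits Pretriangulated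

universe w

variable {R : Type u} [CommRing R]

/-- The functor sending a module to its submodule of elements killed by a power of `𝔞`. -/
def powTorsionFunctor (𝔞 : Ideal R) : ModuleCat.{u} R ⥤ ModuleCat.{u} R where
  obj N := ModuleCat.of R (powTorsion 𝔞 N)
  map f := ModuleCat.ofHom (f.hom.restrict fun _ hy ↦ map_mem_powTorsion 𝔞 f.hom hy)

instance (𝔞 : Ideal R) : (powTorsionFunctor 𝔞).Additive where

/-- The inclusions of power torsion submodules, for an inclusion of ideals. -/
def powTorsionMap {𝔞 𝔟 : Ideal R} (h : 𝔞 ≤ 𝔟) : powTorsionFunctor 𝔟 ⟶ powTorsionFunctor 𝔞 where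
  app N := ModuleCat.ofHom (Submodule.inclusion (powTorsion_anti h))

/-- The inclusion of the power torsion submodule. -/
def powTorsionι (𝔞 : Ideal R) : powTorsionFunctor 𝔞 ⟶ 𝟭 _ where
  app N := ModuleCat.ofHom (powTorsion 𝔞 N).subtype

variable (K : CochainComplex (ModuleCat.{u} R) ℤ)

/-- The subcomplex of elements killed by a power of `𝔞`. -/
noncomputable abbrev powTorsionComplex (𝔞 : Ideal R) : CochainComplex (ModuleCat.{u} R) ℤ :=
  ((powTorsionFunctor 𝔞).mapHomologicalComplex _).obj K

/-- The inclusions of power torsion subcomplexes, for an inclusion of ideals. -/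
noncomputable def powTorsionComplexMap {𝔞 𝔟 : Ideal R} (h : 𝔞 ≤ 𝔟) :
    powTorsionComplex K 𝔟 ⟶ powTorsionComplex K 𝔞 :=
  (NatTrans.mapHomologicalComplex (powTorsionMap h) _).app K

/-- The inclusion of the power torsion subcomplex. -/
noncomputable def powTorsionComplexι (𝔞 : Ideal R) : powTorsionComplex K 𝔞 ⟶ K where
  f n := (powTorsionι 𝔞).app (K.X n)
  comm' _ _ _ := ((powTorsionι 𝔞).naturality _).symm

lemma powTorsionComplexMap_comp_ι {𝔞 𝔟 : Ideal R} (h : 𝔞 ≤ 𝔟) :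
    powTorsionComplexMap K h ≫ powTorsionComplexι K 𝔞 = powTorsionComplexι K 𝔟 := rfl

instance isIso_powTorsionComplexι_bot : IsIso (powTorsionComplexι K (⊥ : Ideal R)) := by
  have (n : ℤ) : IsIso ((powTorsionComplexι K (⊥ : Ideal R)).f n) := by
    rw [ConcreteCategory.isIso_iff_bijective]
    refine ⟨Subtype.val_injective, fun y ↦ ⟨⟨y, ?_⟩, rfl⟩⟩
    rw [powTorsion_bot]
    trivial
  exact HomologicalComplex.Hom.isIso_of_components _

instance mono_powTorsionComplexMap {𝔞 𝔟 : Ideal R} (h : 𝔞 ≤ 𝔟) :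
    Mono (powTorsionComplexMap K h) := by
  have (n : ℤ) : Mono ((powTorsionComplexMap K h).f n) :=
    (ModuleCat.mono_iff_injective _).2
      (Submodule.inclusion_injective (powTorsion_anti (N := K.X n) h))
  exact HomologicalComplex.mono_of_mono_f _ this

variable {K}

/-- Dividing by the (x) + 𝔞 torsion leaves no x-torsion; divisibility by `x` comes from injectivity
of the terms. -/
lemma isIso_smul_id_cokernel [IsNoetherianRing R] (hK : ∀ n, Module.Injective R (K.X n))
    (𝔞 : Ideal R) (x : R) :
    IsIso (x • 𝟙 (cokernel (powTorsionComplexMap K (le_sup_right : 𝔞 ≤ Ideal.span {x} ⊔ 𝔞)))) := by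
  let f := powTorsionComplexMap K (le_sup_right : 𝔞 ≤ Ideal.span {x} ⊔ 𝔞)
  let S := ShortComplex.mk f (cokernel.π f) (cokernel.condition f)
  have hS : S.ShortExact := { exact := ShortComplex.exact_cokernel f }
  have (n : ℤ) : IsIso ((x • 𝟙 (cokernel f)).f n) := by
    have hSn := hS.map_of_exact (HomologicalComplex.eval _ _ n)
    have hsurj : Function.Surjective ((cokernel.π f).f n) := hSn.moduleCat_surjective_g
    have hex : Function.Exact (f.f n) ((cokernel.π f).f n) :=
      (ShortComplex.ShortExact.moduleCat_exact_iff_function_exact _).1 hSn.exact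
    rw [ConcreteCategory.isIso_iff_bijective]
    have hsmul : ∀ e : (cokernel f).X n, (x • 𝟙 (cokernel f)).f n e = x • e := fun e ↦ rfl
    constructor
    · rw [injective_iff_map_eq_zero]
      intro e he
      obtain ⟨y, rfl⟩ := hsurj e
      rw [hsmul, ← map_smul] at he
      obtain ⟨z, hz⟩ := (hex _).1 he
      refine (hex y).2 ⟨⟨y.1, mem_powTorsion_sup_of_smul_mem y.2 ?_⟩, rfl⟩
      have : x • y.1 = z.1 := congr_arg Subtype.val hz.symm
      rw [this]
      exact z.2
    · intro e
      obtain ⟨y, rfl⟩ := hsurj e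
      have := hK n
      obtain ⟨z, hz, hyz⟩ := exists_sub_smul_mem_powTorsion_sup 𝔞 x y.2
      let z' : (powTorsionComplex K 𝔞).X n := (⟨z, hz⟩ : powTorsion 𝔞 (K.X n))
      refine ⟨(cokernel.π f).f n z', ?_⟩
      rw [hsmul, ← map_smul, ← sub_eq_zero, ← map_sub]
      refine (hex _).2 ⟨-⟨_, hyz⟩, Subtype.ext (neg_sub _ _)⟩
  exact HomologicalComplex.Hom.isIso_of_components _

open DerivedCategory in
/-- The augmentation of a Koszul tower over a complex `K` of injective modules lifts to the
power torsion subcomplex of `K`. -/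
lemma KoszulTower.exists_lift_powTorsionComplex [IsNoetherianRing R]
    [HasDerivedCategory.{w} (ModuleCat.{u} R)] (hK : ∀ n, Module.Injective R (K.X n))
    {xs : List R} {P : DerivedCategory (ModuleCat.{u} R)} {q : P ⟶ Q.obj K}
    (hP : KoszulTower (Q.obj K) xs P q) :
    ∃ w : P ⟶ Q.obj (powTorsionComplex K (Ideal.ofList xs)),
      w ≫ Q.map (powTorsionComplexι K _) = q := by
  induction hP with
  | nil =>
    rw [Ideal.ofList_nil]
    exact ⟨inv (Q.map (powTorsionComplexι K ⊥)), IsIso.inv_hom_id _⟩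
  | @cons xs P P' q x p h hP hT ih =>
    obtain ⟨w, rfl⟩ := ih
    rw [Ideal.ofList_cons]
    let f := powTorsionComplexMap K
      (le_sup_right : Ideal.ofList xs ≤ Ideal.span {x} ⊔ Ideal.ofList xs)
    let S := ShortComplex.mk f (cokernel.π f) (cokernel.condition f)
    have hS : S.ShortExact := { exact := ShortComplex.exact_cokernel f }
    have := isIso_smul_id_cokernel hK (Ideal.ofList xs) x
    have : IsIso (x • 𝟙 (Q.obj S.X₃)) := by
      rw [← Q.map_id, ← Functor.map_smul]
      infer_instance
    obtain ⟨w', hw'⟩ := exists_lift_fibre hT (triangleOfSES_distinguished hS) w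
    refine ⟨w', ?_⟩
    rw [← powTorsionComplexMap_comp_ι K le_sup_right, Functor.map_comp, ← Category.assoc,
      ← Category.assoc]
    exact congr($hw' ≫ _)

end PowTorsionComplex

/-! ### Truncating the power torsion subcomplex. -/

section Truncation

open HomologicalComplex

variable {R : Type u} [CommRing R]

/-- If the `𝔞`-power torsion cycles in degree `s` of a complex `K` form an injective module, then
the `𝔞`-power torsion subcomplex maps to `K` by the identity on cycles of degree at most `s` and by
zero in the degrees above `s`. -/
lemma exists_truncation_powTorsionComplex (K : CochainComplex (ModuleCat.{u} R) ℤ) (𝔞 : Ideal R)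
    (s : ℤ) (hs : Module.Injective R (LinearMap.ker (K.d s (s + 1)).hom ⊓
      powTorsion 𝔞 (K.X s) : Submodule R (K.X s))) :
    ∃ π : powTorsionComplex K 𝔞 ⟶ K,
      (∀ p ≤ s, ∀ y : (powTorsionComplex K 𝔞).X p, (powTorsionComplex K 𝔞).d p (p + 1) y = 0 →
        π.f p y = (powTorsionComplexι K 𝔞).f p y) ∧ ∀ p, s < p → π.f p = 0 := by
  let T := powTorsionComplex K 𝔞
  let j : T ⟶ K := powTorsionComplexι K 𝔞
  have key : ∀ p, p = s → ∃ r : T.X p ⟶ K.X p, (∀ y, T.d p (p + 1) y = 0 → r y = j.f p y) ∧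
      r ≫ K.d p (p + 1) = 0 := by
    rintro p rfl
    let Z : Submodule R (K.X p) := LinearMap.ker (K.d p (p + 1)).hom ⊓ powTorsion 𝔞 (K.X p)
    -- Injectivity of the cycles gives a retraction onto them, to be used in degree `s`.
    obtain ⟨r, hr⟩ := hs.out (Submodule.inclusion (inf_le_right : Z ≤ powTorsion 𝔞 (K.X p)))
      (Submodule.inclusion_injective _) LinearMap.id
    refine ⟨ModuleCat.ofHom (Z.subtype ∘ₗ r), fun y hy ↦ ?_, ?_⟩
    · have hyZ : y.1 ∈ Z := ⟨congr_arg Subtype.val hy, y.2⟩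
      exact congr_arg Subtype.val (hr ⟨y.1, hyZ⟩)
    · ext y
      exact (r y).2.1
  choose r hr hr' using key
  let f (p : ℤ) : T.X p ⟶ K.X p := if p < s then j.f p else if h : p = s then r p h else 0
  have hf₁ : ∀ p, p < s → f p = j.f p := fun p hp ↦ if_pos hp
  have hf₂ : ∀ p (hp : p = s), f p = r p hp := fun p hp ↦ by
    simp only [f, hp, lt_irrefl, if_false, dite_true]
  have hf₃ : ∀ p, s < p → f p = 0 := fun p hp ↦ by
    simp only [f, not_lt_of_gt hp, hp.ne', if_false, dite_false]
  refine ⟨{ f := f, comm' := ?_ }, fun p hp y hy ↦ ?_, hf₃⟩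
  · rintro p _ rfl
    rcases lt_trichotomy p s with hp | hp | hp
    · rw [hf₁ p hp, j.comm]
      rcases (Int.add_one_le_of_lt hp).lt_or_eq with hp' | hp'
      · rw [hf₁ _ hp']
      · rw [hf₂ _ hp']
        ext y
        refine (hr _ hp' _ ?_).symm
        exact congr($(T.d_comp_d p (p + 1) (p + 1 + 1)) y)
    · rw [hf₂ p hp, hr' p hp, hf₃ (p + 1) (by lia), Limits.comp_zero]
    · rw [hf₃ p hp, hf₃ (p + 1) (by lia), Limits.comp_zero, Limits.zero_comp]
  · change f p y = j.f p y
    rcases hp.lt_or_eq with hp | hp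
    · rw [hf₁ p hp]
    · rw [hf₂ p hp, hr p hp y hy]

end Truncation

/-! ### Derived maps into K-injective complexes as homotopy classes. -/

section KInjective

open HomologicalComplex DerivedCategory

universe w v' u'

variable {C : Type u'} [Category.{v'} C] [Abelian C] [HasDerivedCategory.{w} C]

lemma exists_Q_map_eq_of_isKInjective {K L : CochainComplex C ℤ} [L.IsKInjective]
    (g : Q.obj K ⟶ Q.obj L) : ∃ φ : K ⟶ L, Q.map φ = g := by
  obtain ⟨ψ, hψ⟩ := (CochainComplex.IsKInjective.Qh_map_bijective
    ((HomotopyCategory.quotient _ _).obj K) L).2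
    ((quotientCompQhIso C).hom.app K ≫ g ≫ (quotientCompQhIso C).inv.app L)
  obtain ⟨φ, rfl⟩ := (HomotopyCategory.quotient _ _).map_surjective ψ
  refine ⟨φ, ?_⟩
  rw [← cancel_epi ((quotientCompQhIso C).hom.app K), ← quotientCompQhIso_hom_naturality, hψ]
  simp

lemma nonempty_homotopy_zero_of_Q_map_eq_zero {K L : CochainComplex C ℤ} [L.IsKInjective]
    (φ : K ⟶ L) (h : Q.map φ = 0) : Nonempty (Homotopy φ 0) := by
  refine ⟨HomotopyCategory.homotopyOfEq _ _ ((CochainComplex.IsKInjective.Qh_map_bijective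
    ((HomotopyCategory.quotient _ _).obj K) L).1 ?_)⟩
  rw [← cancel_mono ((quotientCompQhIso C).hom.app L), quotientCompQhIso_hom_naturality,
    quotientCompQhIso_hom_naturality, h, Functor.map_zero]

lemma exists_comp_d_eq_of_Q_map_eq_zero {L : CochainComplex C ℤ} [L.IsKInjective] {X : C} {j : ℤ}
    (h : ∀ φ : (single C (.up ℤ) j).obj X ⟶ L, Q.map φ = 0) (f : X ⟶ L.X j)
    (hf : f ≫ L.d j (j + 1) = 0) (i : ℤ) (hij : i + 1 = j) :
    ∃ g : X ⟶ L.X i, g ≫ L.d i j = f := by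
  let φ : (single C (.up ℤ) j).obj X ⟶ L := mkHomFromSingle f (by rintro _ rfl; exact hf)
  obtain ⟨H⟩ := nonempty_homotopy_zero_of_Q_map_eq_zero φ (h φ)
  have hc := H.comm j
  rw [prevD_eq H.hom (show (ComplexShape.up ℤ).Rel i j from hij),
    dNext_eq H.hom (show (ComplexShape.up ℤ).Rel j (j + 1) from rfl), single_obj_d,
    Limits.zero_comp, zero_add, zero_f, add_zero, mkHomFromSingle_f] at hc
  refine ⟨(singleObjXSelf (.up ℤ) j X).inv ≫ H.hom j i, ?_⟩
  rw [Category.assoc, ← hc, Iso.inv_hom_id_assoc]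

open Abelian in
/-- `Ext` vanishes if all morphisms to an injective resolution vanish in the derived category. -/
lemma subsingleton_ext_of_Q_map_eq_zero [HasExt.{v'} C] {X Y : C} (I : InjectiveResolution Y)
    (j : ℕ) (h : ∀ φ : (single C (.up ℤ) (j : ℤ)).obj X ⟶ I.cochainComplex, Q.map φ = 0) :
    Subsingleton (Ext X Y j) := by
  refine subsingleton_of_forall_eq 0 fun x ↦ ?_
  obtain ⟨f, hf, rfl⟩ := I.extMk_surjective x (j + 1) rfl
  obtain ⟨g, hg⟩ := exists_comp_d_eq_of_Q_map_eq_zero h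
    (f ≫ (I.cochainComplexXIso j j rfl).inv) (by
      rw [I.cochainComplex_d j (j + 1) j (j + 1) rfl (by simp), Category.assoc,
        Iso.inv_hom_id_assoc, reassoc_of% hf, Limits.zero_comp]) (j - 1) (by lia)
  -- In degree 0 the map `g` lands in degree -1, where the resolution is zero.
  cases j with
  | zero =>
    have hf0 : f = 0 := by
      rw [← cancel_mono (I.cochainComplexXIso (0 : ℕ) 0 rfl).inv, ← hg, Limits.zero_comp,
        (I.cochainComplex.isZero_of_isStrictlyGE 0 _ (by simp)).eq_of_tgt g 0, Limits.zero_comp]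
    subst hf0
    exact I.extMk_zero _ _
  | succ j =>
    rw [I.extMk_eq_zero_iff f _ _ hf j rfl]
    refine ⟨g ≫ (I.cochainComplexXIso _ j (by simp)).hom, ?_⟩
    rw [← cancel_mono (I.cochainComplexXIso ((j + 1 : ℕ) : ℤ) (j + 1) rfl).inv, ← hg,
      I.cochainComplex_d _ ((j + 1 : ℕ) : ℤ) j (j + 1) (by simp) rfl, Category.assoc,
      Category.assoc]

end KInjective

/-! ### Persistence of a gap in the Bass numbers. -/

section Gap

open HomologicalComplex DerivedCategory Abelian

universe w

variable {R : Type u} [CommRing R]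

section

variable [HasDerivedCategory.{w} (ModuleCat.{u} R)]

lemma hom_single_shift_eq_zero (n : ℤ) (hn : 1 ≤ n)
    (f : (singleFunctor (ModuleCat.{u} R) 0).obj (ModuleCat.of R R) ⟶
      ((singleFunctor (ModuleCat.{u} R) 0).obj (ModuleCat.of R R))⟦n⟧) : f = 0 := by
  obtain ⟨m, rfl⟩ : ∃ m : ℕ, n = ((m + 1 : ℕ) : ℤ) := ⟨(n - 1).toNat, by lia⟩
  obtain ⟨e, rfl⟩ := (Ext.homEquiv (X := ModuleCat.of R R) (Y := ModuleCat.of R R)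
    (n := m + 1)).surjective f
  rw [Ext.eq_zero_of_projective e]
  exact Ext.zero_hom _ _ _

lemma exists_eq_smul_id_single
    (f : (singleFunctor (ModuleCat.{u} R) 0).obj (ModuleCat.of R R) ⟶
      (singleFunctor (ModuleCat.{u} R) 0).obj (ModuleCat.of R R)) : ∃ r : R, f = r • 𝟙 _ := by
  obtain ⟨g, rfl⟩ := (singleFunctor (ModuleCat.{u} R) 0).map_surjective f
  refine ⟨g.hom 1, ?_⟩
  rw [← CategoryTheory.Functor.map_id, ← Functor.map_smul]
  congr 1
  ext
  simp

lemma hom_shift_eq_zero_of_iso {A B : DerivedCategory (ModuleCat.{u} R)} (e : B ≅ A) (n : ℤ)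
    (hB : ∀ f : B ⟶ B⟦n⟧, f = 0) (f : A ⟶ A⟦n⟧) : f = 0 := by
  rw [← cancel_epi e.hom, ← cancel_mono (e.inv⟦n⟧'), hB ((e.hom ≫ f) ≫ _), Limits.comp_zero,
    Limits.zero_comp]

lemma exists_eq_smul_id_of_iso {A B : DerivedCategory (ModuleCat.{u} R)} (e : B ≅ A)
    (hB : ∀ f : B ⟶ B, ∃ r : R, f = r • 𝟙 B) (f : A ⟶ A) : ∃ r : R, f = r • 𝟙 A := by
  obtain ⟨r, hr⟩ := hB (e.hom ≫ f ≫ e.inv)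
  refine ⟨r, ?_⟩
  rw [← cancel_epi e.hom, ← cancel_mono e.inv, Category.assoc, hr]
  simp

lemma smul_id_Q_single_eq_zero (X : ModuleCat.{u} R) (x : R) (hx : ∀ y : X, x • y = 0) (j : ℤ) :
    x • 𝟙 (Q.obj ((single (ModuleCat.{u} R) (.up ℤ) j).obj X)) = 0 := by
  have h : x • 𝟙 X = 0 := by
    ext y
    exact hx y
  rw [← CategoryTheory.Functor.map_id, ← Functor.map_smul, ← CategoryTheory.Functor.map_id]
  have : x • (single (ModuleCat.{u} R) (.up ℤ) j).map (𝟙 X) = 0 := by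
    apply HomologicalComplex.from_single_hom_ext
    rw [HomologicalComplex.smul_f_apply, single_map_f_self, ← Linear.comp_smul, ← Linear.smul_comp, h]
    simp
  rw [this, Functor.map_zero]

end

/-- A chain map out of a complex concentrated in degree j only meets the cycles there, which is
where the truncation map is controlled. -/
lemma comp_eq_comp_of_forall_cycles {X : ModuleCat.{u} R} {j : ℤ}
    {T K : CochainComplex (ModuleCat.{u} R) ℤ}
    (φ : (single (ModuleCat.{u} R) (.up ℤ) j).obj X ⟶ T) (a b : T ⟶ K)
    (h : ∀ y : T.X j, T.d j (j + 1) y = 0 → a.f j y = b.f j y) : φ ≫ a = φ ≫ b := by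
  apply from_single_hom_ext
  rw [comp_f, comp_f]
  ext y
  refine h _ ?_
  have := φ.comm j (j + 1)
  rw [single_obj_d, Limits.zero_comp] at this
  exact congr($this y)

variable [IsLocalRing R] [IsNoetherianRing R]

/-- The cycles of the `𝔪`-power torsion subcomplex of an injective resolution of `Y` in degree `s`
form an injective module, if `Ext` of the residue field vanishes in degree `s + 1`. -/
lemma injective_cycles_powTorsion {Y : ModuleCat.{u} R} (I : InjectiveResolution Y) (s : ℕ)
    (h : Subsingleton (Ext (ModuleCat.of R (R ⧸ maximalIdeal R)) Y (s + 1))) :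
    Module.Injective R (LinearMap.ker (I.cochainComplex.d (s : ℤ) (s + 1)).hom ⊓
      powTorsion (maximalIdeal R) (I.cochainComplex.X (s : ℤ)) :
        Submodule R (I.cochainComplex.X (s : ℤ))) := by
  have : Module.Injective R (I.cochainComplex.X (s : ℤ)) :=
    (Module.injective_iff_injective_object R _).2
      (inferInstanceAs (Injective (I.cochainComplex.X (s : ℤ))))
  refine injective_ker_inf_powTorsion (I.cochainComplex.d (s : ℤ) (s + 1)).hom
    (I.cochainComplex.d ((s : ℤ) + 1) (s + 1 + 1)).hom ?_ _ fun 𝔠 c hc g hg ↦ ?_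
  · rw [← ModuleCat.hom_comp, I.cochainComplex.d_comp_d]
    rfl
  · have hext := subsingleton_ext_of_pow_le_annihilator Y (s + 1) h (R ⧸ 𝔠) c
      (by rwa [Ideal.annihilator_quotient])
    let e₀ := I.cochainComplexXIso (s : ℤ) s rfl
    let e₁ := I.cochainComplexXIso ((s : ℤ) + 1) (s + 1) (by simp)
    let e₂ := I.cochainComplexXIso ((s : ℤ) + 1 + 1) (s + 1 + 1) (by simp)
    have hg' : ModuleCat.ofHom g ≫ I.cochainComplex.d ((s : ℤ) + 1) (s + 1 + 1) = 0 :=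
      ModuleCat.hom_ext hg
    rw [I.cochainComplex_d ((s : ℤ) + 1) (s + 1 + 1) (s + 1) (s + 1 + 1) (by simp) (by simp)] at hg'
    have hg'' : (ModuleCat.ofHom g ≫ e₁.hom) ≫ I.cocomplex.d (s + 1) (s + 1 + 1) = 0 := by
      rw [← cancel_mono e₂.inv, Limits.zero_comp, Category.assoc, Category.assoc]
      exact hg'
    -- The cocycle `g` represents a class in Ext^{s+1}(R ⧸ 𝔠, Y) = 0, so it is a coboundary.
    obtain ⟨t, ht⟩ := (I.extMk_eq_zero_iff _ (s + 1 + 1) rfl hg'' s rfl).1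
      (Subsingleton.elim _ _)
    refine ⟨(t ≫ e₀.inv).hom, ?_⟩
    rw [← ModuleCat.hom_comp, ← ModuleCat.hom_ofHom g]
    congr 1
    rw [I.cochainComplex_d (s : ℤ) (s + 1) s (s + 1) rfl (by simp), Category.assoc,
      Iso.inv_hom_id_assoc, ← Category.assoc, ht, Category.assoc, Iso.hom_inv_id, Category.comp_id]

/-- A gap in the Bass numbers of a Noetherian local ring `R` above the depth forces the vanishing of
all the subsequent Bass numbers. -/
theorem subsingleton_ext_residue_of_gap (s : ℕ)
    (h : Subsingleton (Ext (ModuleCat.of R (R ⧸ maximalIdeal R)) (ModuleCat.of R R) (s + 1)))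
    (h₀ : ¬ ∀ j ≤ s, Subsingleton (Ext (ModuleCat.of R (R ⧸ maximalIdeal R)) (ModuleCat.of R R) j))
    (j : ℕ) (hj : s + 1 ≤ j) :
    Subsingleton (Ext (ModuleCat.of R (R ⧸ maximalIdeal R)) (ModuleCat.of R R) j) := by
  let := HasDerivedCategory.standard (ModuleCat.{u} R)
  let k := ModuleCat.of R (R ⧸ maximalIdeal R)
  let I : InjectiveResolution (ModuleCat.of R R) := InjectiveResolution.of _
  let K := I.cochainComplex
  have hK (n : ℤ) : Module.Injective R (K.X n) :=
    (Module.injective_iff_injective_object R _).2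
      (inferInstanceAs (Injective (I.cochainComplex.X n)))
  let T := powTorsionComplex K (maximalIdeal R)
  have hT (n : ℤ) : Injective (T.X n) :=
    (Module.injective_iff_injective_object R _).1
      (injective_powTorsion (E := K.X n) (maximalIdeal R))
  have : T.IsStrictlyGE 0 := by
    rw [CochainComplex.isStrictlyGE_iff]
    intro i hi
    exact (powTorsionFunctor (maximalIdeal R)).map_isZero (K.isZero_of_isStrictlyGE 0 i hi)
  have : T.IsKInjective := CochainComplex.isKInjective_of_injective T 0
  obtain ⟨π, hπ, hπ'⟩ := exists_truncation_powTorsionComplex K (maximalIdeal R) s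
    (injective_cycles_powTorsion I s h)
  obtain ⟨S, hS⟩ := (isNoetherianRing_iff_ideal_fg R).1 ‹_› (maximalIdeal R)
  have hxs : Ideal.ofList S.toList = maximalIdeal R := by
    rw [← hS]
    simp [Ideal.ofList]
  obtain ⟨P, q, hP⟩ := exists_koszulTower (R := R) (Q.obj K) S.toList
  obtain ⟨w, hw⟩ : ∃ w : P ⟶ Q.obj T, w ≫ Q.map (powTorsionComplexι K _) = q := by
    dsimp only [T]
    rw [← hxs]
    exact hP.exists_lift_powTorsionComplex hK
  let e : (singleFunctor (ModuleCat.{u} R) 0).obj (ModuleCat.of R R) ≅ Q.obj K :=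
    have : IsIso (Q.map I.ι') := (isIso_Q_map_iff_quasiIso _ I.ι').2 inferInstance
    (singleFunctorIsoCompQ (ModuleCat.{u} R) 0).app _ ≪≫ asIso (Q.map I.ι')
  obtain ⟨r, hr⟩ := hP.exists_eq_smul
    (fun n hn ↦ hom_shift_eq_zero_of_iso e n (hom_single_shift_eq_zero n hn))
    (exists_eq_smul_id_of_iso e exists_eq_smul_id_single) (w ≫ Q.map π)
  have hk : ∀ x ∈ maximalIdeal R, ∀ y : k, x • y = 0 := fun x hx y ↦
    Module.mem_annihilator.1 ((Ideal.annihilator_quotient (I := maximalIdeal R)).ge hx) y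
  have hkD (x : R) (hx : x ∈ maximalIdeal R) (i : ℤ) :=
    smul_id_Q_single_eq_zero k x (hk x hx) i
  have main (i : ℤ) (f : (single (ModuleCat.{u} R) (.up ℤ) i).obj k ⟶ K) :
      ∃ φ : (single (ModuleCat.{u} R) (.up ℤ) i).obj k ⟶ T,
        Q.map (φ ≫ powTorsionComplexι K _) = Q.map f ∧ Q.map (φ ≫ π) = r • Q.map f := by
    obtain ⟨g, hg⟩ := hP.exists_factor (fun x hx ↦ hkD x
      (hxs ▸ Ideal.subset_span (by simpa using hx)) i) (Q.map f)
    obtain ⟨φ, hφ⟩ := exists_Q_map_eq_of_isKInjective (g ≫ w)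
    refine ⟨φ, ?_, ?_⟩
    · rw [Functor.map_comp, hφ, Category.assoc, hw, hg]
    · rw [Functor.map_comp, hφ, Category.assoc, hr, Linear.comp_smul, hg]
  -- In degrees at most `s` both composites of `φ` agree, so `f = r • f` in the derived category; if
  -- r ∈ 𝔪 this is zero, against `h₀`.
  have hr_unit : IsUnit r := by
    by_contra hr'
    refine h₀ fun i hi ↦ subsingleton_ext_of_Q_map_eq_zero I i fun f ↦ ?_
    obtain ⟨φ, hφ, hφ'⟩ := main i f
    rw [comp_eq_comp_of_forall_cycles φ π (powTorsionComplexι K _) (hπ i (by exact_mod_cast hi)),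
      hφ] at hφ'
    rw [hφ', ← Category.id_comp (Q.map f), ← Linear.smul_comp,
      hkD r ((mem_maximalIdeal r).2 hr'), Limits.zero_comp]
  refine subsingleton_ext_of_Q_map_eq_zero I j fun f ↦ ?_
  obtain ⟨φ, -, hφ⟩ := main j f
  -- Above degree `s` the map `π` is zero, so the unit `r` kills `f`.
  rw [comp_eq_comp_of_forall_cycles φ π 0 (fun y _ ↦ by
    rw [hπ' j (by lia), zero_f]), Limits.comp_zero, Functor.map_zero] at hφ
  obtain ⟨r, rfl⟩ := hr_unit
  rw [← one_smul R (Q.map f), ← r.inv_mul, mul_smul, ← hφ, smul_zero]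

end Gap

end BurchSubmodule

theorem mainTheorem3 {R : Type u} [CommRing R] [IsLocalRing R] [IsNoetherianRing R]
    {L : Type u} [AddCommGroup L] [Module R L] [Module.Free R L] [Module.Finite R L]
    (M : Submodule R L) (hM : BurchSubmodule.IsBurch M)
    (m : ℕ) (hm : max (BurchSubmodule.depth R - 1) 0 ≤ (m : ℕ∞))
    (hExt : ∀ i : ℕ, i = m ∨ i = m + 1 ∨ i = m + 2 →
      Subsingleton (Abelian.Ext (ModuleCat.of R M) (ModuleCat.of R R) i)) :
    BurchSubmodule.IsGorensteinLocal R := by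
  have hk := BurchSubmodule.subsingleton_ext_residue_of_isBurch hM (ModuleCat.of R R) m
    (hExt m (by simp)) (hExt (m + 1) (by simp))
  have hgap := BurchSubmodule.subsingleton_ext_residue_of_gap m hk fun h ↦ by
    -- Vanishing in degrees 0 to m, together with `hk` in degree m + 1, would give depth at least m
    -- + 2, whereas `hm` allows at most m + 1.
    have hle := BurchSubmodule.le_depth_of_subsingleton_ext (R := R) (m + 2) fun j hj ↦ by
      rcases (show j ≤ m ∨ j = m + 1 by lia) with hj | rfl
      exacts [h j hj, hk]
    have hd : BurchSubmodule.depth R ≤ (m : ℕ∞) + 1 :=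
      tsub_le_iff_right.1 ((le_max_left _ _).trans hm)
    have := hle.trans hd
    norm_cast at this
    lia
  refine ⟨inferInstance, inferInstance, m,
    BurchSubmodule.hasInjectiveDimensionLE_of_subsingleton_ext m _ fun 𝔞 ↦ ?_⟩
  exact BurchSubmodule.subsingleton_ext_of_residue (ModuleCat.of R R) (m + 1) hgap _ _ le_rfl
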